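/- **Codes.** A block code encodes a file of $\mathcal M$ symbols of a finite field $\mathbb F$ into nodes, each storing $\alpha$ symbols of $\mathbb F$; the nodes are arranged in $b$ blocks of $c$ nodes. It is a $(k_c,\rho)$ *BFR code* if the file is determined by any $k_c$ nodes of each of any $b-\rho$ blocks; put $k=(b-\rho)k_c$. It is a *BFR regenerating code* with parameters $(k_c,\rho,d_r,\sigma,\beta)$ if, moreover, every node of a block is determined by $\beta$ symbols sent by each of any $d_r$ nodes of each of any $b-\sigma$ other blocks. It has *minimum storage* if $\alpha=\mathcal M/k$, and it is *BFR-MSR* if it has minimum storage and its $\beta$ is the smallest possible for the given $(c,b,\mathcal M,k_c,\rho,\alpha,d_r,\sigma)$ over all finite fields. The *resilience* of a code for access to $k_c$ nodes per block is $\rho=b-\max|\mathcal B^*|-1$, the maximum being over the sets $\mathcal B^*$ of blocks for which some choice of $k_c$ nodes in each block of $\mathcal B^*$ has content of $|\mathbb F|$-ary entropy less than $\mathcal M$ for a uniformly random file. Let the $b$ blocks be divided into $b/b_L$ disjoint local groups of $b_L$ blocks. A code is a *minimum-storage LRC* (resp. a *BFR-MSR-LRC*) with $\rho_L=0$ and local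 data size $K_L$ if for every local group the local codewords are codewords of a minimum-storage BFR regenerating code (resp. a BFR-MSR code) on $b_L$ blocks with $\rho=0$ and file size $K_L$; its resilience is taken for the same number $k_c$ of nodes per block as in the local codes. In particular, every BFR-MSR-LRC is a minimum-storage LRC. **Construction VI.** Let $\sigma_L<b_L-1$ and let $\tilde{\mathcal C}$ be a linear minimum storage regenerating (MSR) code over $\mathbb F_q$ with $\tilde n=(b_L-1)c$ nodes, $\tilde k=(b_L-1)k_c$, $\tilde d=(b_L-\sigma_L-1)d_r$, $d_r\le c$, file size $\tilde{\mathcal M}=\tilde k\tilde\alpha$ and $\tilde\alpha=(\tilde d-\tilde k+1)\tilde\beta$. Let $N=b(b_L-\sigma_L)\tilde{\mathcal M}$ and $1\le\mathcal M\le N$. Encode a file of $\mathcal M$ symbols of $\mathbb F_{q^m}$ by a Gabidulin code of length $N$ and dimension $\mathcal M$ (evaluation at $N$ points of $\mathbb F_{q^m}$ that are linearly independent over $\mathbb F_q$), and divide the codeword into $b/b_L$ groups of $K_L=Nb_L/b$ symbols. In each group, divide the $K_L$ symbols into $(b_L-\sigma_L)b_L$ parts of size $\tilde{\mathcal M}$,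 indexed by $(t,j)$ with $1\le t\le b_L-\sigma_L$, $1\le j\le b_L$; encode each part by $\tilde{\mathcal C}$, and distribute the $\tilde n$ node contents of the codeword of part $(t,j)$ over the $c$ nodes of each block $l\ne j$ of the group, one to each node. Each node thus stores $\alpha=(b_L-1)(b_L-\sigma_L)\tilde\alpha$ symbols. **Statement.** Suppose that $\frac Nb\mid\mathcal M$. Then: 1. The local codes of Construction VI are minimum-storage BFR regenerating codes with parameters $(k_c,0,d_r,\sigma_L,\beta)$ and file size $K_L$, where $\beta=(b_L-\sigma_L-1)(b_L-1)\tilde\beta$, so the code is a minimum-storage LRC with $\rho_L=0$; if $\mathcal M\ge K_L$, the restriction of the code to each local group is the whole local code. If $k_L:=b_Lk_c=b_L/\sigma_L$, the local codes are BFR-MSR codes, so the code is a BFR-MSR-LRC. 2. Every minimum-storage LRC with $\rho_L=0$ and resilience $\rho\ge0$, in particular every BFR-MSR-LRC, satisfies $$\mathcal M\le\mu K_L+\frac{K_L\varphi}{b_L},\qquad \mu=\Big\lfloor\frac{b-\rho}{b_L}\Big\rfloor,\quad \varphi=b-\rho-\mu b_L .$$ 3. The code of Construction VI has some resilience $\rho\ge0$,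 its file can be decoded from any $k_c$ nodes of each of any $b-\rho$ blocks, and it attains this bound with equality. Hence it is optimal with respect to file size: every minimum-storage LRC with the same $b,b_L,K_L$, $\rho_L=0$ and resilience at least $\rho$ has file size at most $\mathcal M$. -/

import Mathlib

/-- A block code: `M` file symbols over the alphabet `F` are encoded into nodes `(i, j)`, where `i` is
a block and `j` one of its `c` nodes; every node stores `α` symbols. The number of nodes is
`n = |B| * c`. The encoder need not be linear. -/
abbrev BlockCode (F : Type*) (M : ℕ) (B : Type*) (c α : ℕ) : Type _ :=
  (Fin M → F) → B → Fin c → (Fin α → F)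

namespace BlockCode

variable {F B : Type*} {M c α : ℕ}

/-- The part of the codeword seen by a data collector that reads the nodes `A i` of every
block `i ∈ S`. -/
def observe (C : BlockCode F M B c α) (S : Finset B) (A : B → Finset (Fin c)) (f : Fin M → F)
    (x : {x : B × Fin c // x.1 ∈ S ∧ x.2 ∈ A x.1}) : Fin α → F :=
  C f x.1.1 x.1.2

/-- Block failure resilient code: the file can be decoded from any `kc` nodes of each of any `b - ρ`
blocks, i.e. from `k = (b - ρ) * kc` nodes. -/
def IsBFR [Fintype B] (C : BlockCode F M B c α) (kc ρ : ℕ) : Prop :=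
  ρ < Fintype.card B ∧ kc ≤ c ∧
    ∀ (S : Finset B) (A : B → Finset (Fin c)), S.card = Fintype.card B - ρ →
      (∀ i ∈ S, (A i).card = kc) → Function.Injective (C.observe S A)

/-- Block failure resilient regenerating code: a BFR code in which every node `j` of a failed
block `i` can be rebuilt from any `dr` nodes of each of any `b - σ` blocks other than `i`, each of
these `d = (b - σ) * dr` helpers sending `β` symbols computed from its own content. -/
def IsBFRRC [Fintype B] (C : BlockCode F M B c α) (kc ρ dr σ β : ℕ) : Prop :=
  C.IsBFR kc ρ ∧ σ < Fintype.card B ∧ dr ≤ c ∧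
    ∀ (i : B) (j : Fin c) (S : Finset B) (A : B → Finset (Fin c)), i ∉ S →
      S.card = Fintype.card B - σ → (∀ l ∈ S, (A l).card = dr) →
      ∃ h : B → Fin c → (Fin α → F) → (Fin β → F), ∀ f f' : Fin M → F,
        (∀ l ∈ S, ∀ m ∈ A l, h l m (C f l m) = h l m (C f' l m)) → C f i j = C f' i j

/-- A BFR regenerating code with the minimum per-node storage `α = M / k`, `k = (b - ρ) * kc`. -/
def IsMinStorage [Fintype B] (C : BlockCode F M B c α) (kc ρ dr σ β : ℕ) : Prop :=
  C.IsBFRRC kc ρ dr σ β ∧ M = (Fintype.card B - ρ) * kc * α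

/-- BFR-MSR code: minimum per-node storage and, among all BFR regenerating codes over finite fields
with the same `(n, b, M, k, ρ, α, d, σ)`, minimum repair bandwidth `d * β`
(equivalently minimum `β`, as `d` is fixed). -/
def IsBFRMSR [Fintype B] (C : BlockCode F M B c α) (kc ρ dr σ β : ℕ) : Prop :=
  C.IsMinStorage kc ρ dr σ β ∧
    ∀ (F' : Type) [Field F'] [Fintype F'] (C' : BlockCode F' M B c α) (β' : ℕ),
      C'.IsBFRRC kc ρ dr σ β' → β ≤ β'

end BlockCode

open Classical in
/-- The `q`-entropy of `g ω` for `ω` uniformly distributed on the finite set `Ω`. -/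
noncomputable def qEntropy {Ω S : Type*} [Fintype Ω] (q : ℕ) (g : Ω → S) : ℝ :=
  -∑ s ∈ Finset.univ.image g,
    (((Finset.univ.filter fun ω => g ω = s).card : ℝ) / Fintype.card Ω) *
      Real.logb q (((Finset.univ.filter fun ω => g ω = s).card : ℝ) / Fintype.card Ω)

/-- The resilience `b - max {|S| : H(c(S)) < M} - 1` of a code for a uniformly distributed file,
where `c(S)` is what a data collector reads from `kc` nodes of each block of `S`; the maximum is over
all sets `S` of blocks and all choices of the nodes that are read. -/
noncomputable def BlockCode.resilience {F B : Type*} [Fintype F] [Fintype B] {M c α : ℕ}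
    (C : BlockCode F M B c α) (kc : ℕ) : ℤ :=
  (Fintype.card B : ℤ) -
    (sSup {s : ℕ | ∃ (S : Finset B) (A : B → Finset (Fin c)), S.card = s ∧
      (∀ i ∈ S, (A i).card = kc) ∧ qEntropy (Fintype.card F) (C.observe S A) < M} : ℕ) - 1

namespace BlockCode

variable {F : Type*} {M g bL c α : ℕ}

/-- The restriction of a code to the `i`-th local group. The blocks are `Fin g × Fin bL`: there are `g`
disjoint local groups of `bL` blocks each. -/
def puncture (C : BlockCode F M (Fin g × Fin bL) c α) (i : Fin g) : BlockCode F M (Fin bL) c α :=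
  fun f l => C f (i, l)

/-- Locally repairable code whose local groups are protected by minimum-storage BFR regenerating
codes with local data size `KL` and local resilience `ρL`. -/
def IsMinStorageLRC (C : BlockCode F M (Fin g × Fin bL) c α) (KL kc ρL dr σ β : ℕ) : Prop :=
  ∀ i : Fin g, ∃ E : BlockCode F KL (Fin bL) c α,
    Set.range (C.puncture i) ⊆ Set.range E ∧ E.IsMinStorage kc ρL dr σ β

/-- BFR-MSR-LRC: the local groups are protected by BFR-MSR codes. -/
def IsBFRMSRLRC (C : BlockCode F M (Fin g × Fin bL) c α) (KL kc ρL dr σ β : ℕ) : Prop :=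
  ∀ i : Fin g, ∃ E : BlockCode F KL (Fin bL) c α,
    Set.range (C.puncture i) ⊆ Set.range E ∧ E.IsBFRMSR kc ρL dr σ β

end BlockCode

/-- The file size bound `μ * K_L + K_L * φ / b_L` for local resilience `ρ_L = 0`, where
`μ = ⌊(b - ρ) / b_L⌋` and `φ = b - ρ - μ * b_L`. -/
def fileSizeBound (b bL KL ρ : ℕ) : ℚ :=
  (((b - ρ) / bL : ℕ) : ℚ) * KL + (KL : ℚ) * (((b - ρ) % bL : ℕ) : ℚ) / bL

/-- `[n, k, d, α, β]` regenerating code for `M` symbols: any `k` nodes determine the file, and any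
node can be rebuilt from `β` symbols of each of any `d` other nodes. -/
def IsRegenerating {F : Type*} {M n α : ℕ} (E : (Fin M → F) → Fin n → (Fin α → F))
    (k d β : ℕ) : Prop :=
  k ≤ d ∧ d < n ∧
    (∀ A : Finset (Fin n), A.card = k → Function.Injective fun f (x : A) => E f x) ∧
    ∀ (i : Fin n) (A : Finset (Fin n)), i ∉ A → A.card = d →
      ∃ h : Fin n → (Fin α → F) → (Fin β → F), ∀ f f' : Fin M → F,
        (∀ j ∈ A, h j (E f j) = h j (E f' j)) → E f i = E f' i

/-- Minimum storage regenerating code: `α = M / k` and `d * β = M * d / (k * (d - k + 1))`. -/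
def IsMSR {F : Type*} {M n α : ℕ} (E : (Fin M → F) → Fin n → (Fin α → F)) (k d β : ℕ) : Prop :=
  IsRegenerating E k d β ∧ M = k * α ∧ α = (d - k + 1) * β

/-- The linear code with generator matrix `G` over `K` (node `i` has the thick column `G i`), applied to
data over an extension `L` of `K`. -/
def linearEncode {K : Type*} (L : Type*) [Field K] [Field L] [Algebra K L] {M n α : ℕ}
    (G : Fin n → Matrix (Fin α) (Fin M) K) (x : Fin M → L) (i : Fin n) (s : Fin α) : L :=
  ∑ t, G i s t • x t

/-- The Gabidulin encoder: the values at the points `y` of the linearized polynomial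
`∑ i, f i * X ^ (q ^ i)`. -/
def gabidulin {L : Type*} [Field L] (q : ℕ) {M N : ℕ} (y : Fin N → L) (f : Fin M → L)
    (m : Fin N) : L :=
  ∑ i : Fin M, f i * y m ^ q ^ (i : ℕ)

/-- The block of the duplicated combination block design with `r` repetition groups of `v` points
which belongs to the set `T` of points: it has the points of `T` in every repetition group. -/
def dcbdBlock (r : ℕ) {v : ℕ} (T : Finset (Fin v)) : Finset (Fin r × Fin v) :=
  Finset.univ ×ˢ T

/-- The block with index `l` in the design with all `(v - 1)`-subsets of the `v` points: block `l`
leaves out the point `l` of every repetition group. -/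
def dcbdRow (r : ℕ) {v : ℕ} (l : Fin v) : Finset (Fin r × Fin v) :=
  dcbdBlock r (Finset.univ.erase l)

/-- The bookkeeping of the placement by the duplicated combination block design with `b` blocks and `r`
repetition groups. -/
structure DCBDLayout (b r c K α m n' α' : ℕ) where
  /-- The `K` data symbols are divided into `r * b` parts of size `m`, one for each point. -/
  split : Fin K ≃ (Fin r × Fin b) × Fin m
  /-- The `n'` codeword symbols of the part `p` are distributed evenly to the blocks that contain `p`:
  each of the `c` nodes of each of these blocks gets one of them. -/
  place : ∀ p : Fin r × Fin b, {l : Fin b // p ∈ dcbdRow r l} × Fin c ≃ Fin n'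
  /-- A node of block `l` stores one codeword symbol, that is `α'` field symbols, for each of
  the points in the block. -/
  store : ∀ l : Fin b, {p : Fin r × Fin b // p ∈ dcbdRow r l} × Fin α' ≃ Fin α

/-- Placement of regenerating codewords by a duplicated combination block design: every part of
the data is encoded by the linear code `G`, and the codewords are placed as the layout says. -/
def dcbdCode {K : Type*} (L : Type*) [Field K] [Field L] [Algebra K L] {b r c KL α m n' α' : ℕ}
    (lay : DCBDLayout b r c KL α m n' α') (G : Fin n' → Matrix (Fin α') (Fin m) K) :
    BlockCode L KL (Fin b) c α :=
  fun x l j s =>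
    let pa := (lay.store l).symm s
    linearEncode L G (fun t => x (lay.split.symm (pa.1.1, t)))
      (lay.place pa.1.1 (⟨l, pa.1.2⟩, j)) pa.2

/-- Gabidulin precoding followed by a `dcbdCode` in every local group: the `N` Gabidulin symbols are
divided into `g` local groups of `KL` symbols each. -/
def gabidulinDcbdCode {K L : Type*} [Field K] [Fintype K] [Field L] [Algebra K L]
    (M : ℕ) {N g bL r c KL α m n' α' : ℕ} (y : Fin N → L) (grp : Fin N ≃ Fin g × Fin KL)
    (lay : DCBDLayout bL r c KL α m n' α') (G : Fin n' → Matrix (Fin α') (Fin m) K) :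
    BlockCode L M (Fin g × Fin bL) c α :=
  fun f il =>
    dcbdCode L lay G (fun t => gabidulin (Fintype.card K) y f (grp.symm (il.1, t))) il.2

/-! The bound is a count. For a uniform file, entropy below `M` means that the observation is not
injective (`qEntropy_lt_iff_not_injective`), so resilience at least `ρ` makes any `b - ρ` blocks
decodable and forces `M ≤ (b - ρ) * kc * α`. Minimum storage with `ρ_L = 0` says `KL = bL * kc * α`,
and then the bound of the theorem is this same number (`fileSizeBound_eq`).

For equality, linear maps over `K` commute with the local encoding (`dcbdCode_map`), so every stored
symbol is the value of the file's linearized polynomial at a `K`-combination of the Gabidulin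
points. Local minimum storage makes the contents of `kc` nodes per block arbitrary, hence the
combinations that a collector sees are independent (`linearIndependent_observed`), and `M` of them
determine the polynomial. So `t` blocks suffice exactly when `M ≤ t * kc * α`; as `N / b = kc * α`
divides `M`, equality holds for some `t`, and `ρ = b - t`.

Locally, the part `(t, j)` lies on all blocks except `j`, so `kc` nodes per block give precisely the
nodes its MSR codeword needs. In a repair one helper block stays idle for each part, chosen so that
the load is balanced (`card_active_le`). The condition for BFR-MSR forces `kc = σ = 1`, where the
cut-set bound `IsBFRRC.storage_le` matches the construction. -/

/-- The number of nodes read by a data collector. -/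
theorem card_observed {B : Type*} [Fintype B] {c kc : ℕ} (S : Finset B)
    (A : B → Finset (Fin c)) (hA : ∀ i ∈ S, (A i).card = kc) :
    Nat.card {x : B × Fin c // x.1 ∈ S ∧ x.2 ∈ A x.1} = S.card * kc := by
  classical
  have e : {x : B × Fin c // x.1 ∈ S ∧ x.2 ∈ A x.1} ≃ (S.sigma A : Finset (Σ _ : B, Fin c)) :=
    { toFun := fun x => ⟨⟨x.1.1, x.1.2⟩, by simpa using x.2⟩
      invFun := fun x => ⟨(x.1.1, x.1.2), Finset.mem_sigma.1 x.2⟩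
      left_inv := fun x => rfl
      right_inv := fun x => rfl }
  rw [Nat.card_congr e, Nat.card_eq_fintype_card, Fintype.card_coe, Finset.card_sigma,
    Finset.sum_const_nat hA]

/-! ### Entropy, resilience and the symbol count -/

/-- For a uniformly distributed file, the entropy of an observation is less than the file size
exactly if the observation does not determine the file. -/
theorem qEntropy_lt_iff_not_injective {F S : Type*} [Field F] [Fintype F] {M : ℕ}
    (g : (Fin M → F) → S) :
    qEntropy (Fintype.card F) g < M ↔ ¬ Function.Injective g := by
  classical
  set q := Fintype.card F with hq
  have hq1 : (1 : ℝ) < q := by exact_mod_cast Fintype.one_lt_card (α := F)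
  have hq0 : (0 : ℝ) < (q : ℝ) ^ M := by positivity
  set n : S → ℕ := fun s => (Finset.univ.filter fun ω => g ω = s).card with hn
  have hcard : (Fintype.card (Fin M → F) : ℝ) = (q : ℝ) ^ M := by simp [hq]
  have hpos : ∀ s ∈ Finset.univ.image g, 1 ≤ n s := by
    intro s hs
    obtain ⟨ω, -, rfl⟩ := Finset.mem_image.1 hs
    exact Finset.card_pos.2 ⟨ω, by simp⟩
  have hsum : ∑ s ∈ Finset.univ.image g, (n s : ℝ) / (q : ℝ) ^ M = 1 := by
    rw [← Finset.sum_div, div_eq_one_iff_eq hq0.ne', ← hcard]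
    have := Finset.card_eq_sum_card_image g (Finset.univ : Finset (Fin M → F))
    rw [Finset.card_univ] at this
    rw [this]
    push_cast
    rfl
  -- The entropy deficit is the mean logarithm of the fibre size; it vanishes exactly when all
  -- nonempty fibres are singletons.
  have key : qEntropy q g = M - ∑ s ∈ Finset.univ.image g,
      (n s : ℝ) / (q : ℝ) ^ M * Real.logb q (n s) := by
    have h1 : qEntropy q g = -∑ s ∈ Finset.univ.image g,
        ((n s : ℝ) / (q : ℝ) ^ M * Real.logb q (n s) - (n s : ℝ) / (q : ℝ) ^ M * M) := by
      unfold qEntropy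
      rw [hcard]
      congr 1
      refine Finset.sum_congr (by congr) fun s hs => ?_
      have hs' : (n s : ℝ) ≠ 0 := by
        have := hpos s (by convert hs)
        positivity
      have : Real.logb q ((n s : ℝ) / (q : ℝ) ^ M) = Real.logb q (n s) - M := by
        rw [Real.logb_div hs' hq0.ne', ← Real.rpow_natCast,
          Real.logb_rpow (by linarith) hq1.ne']
      rw [← mul_sub, ← this]
    rw [h1, Finset.sum_sub_distrib, ← Finset.sum_mul, hsum]
    ring
  have hnn : ∀ s ∈ Finset.univ.image g,
      0 ≤ (n s : ℝ) / (q : ℝ) ^ M * Real.logb q (n s) := by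
    intro s hs
    have : (1 : ℝ) ≤ n s := by exact_mod_cast hpos s hs
    exact mul_nonneg (by positivity) (Real.logb_nonneg hq1 this)
  rw [key, sub_lt_self_iff]
  constructor
  · intro h hinj
    refine h.ne' (Finset.sum_eq_zero fun s hs => ?_)
    have : n s = 1 := by
      refine le_antisymm (Finset.card_le_one.2 ?_) (hpos s hs)
      intro a ha b hb
      simp only [Finset.mem_filter, Finset.mem_univ, true_and] at ha hb
      exact hinj (ha.trans hb.symm)
    simp [this]
  · intro h
    obtain ⟨a, b, hab, hne⟩ := Function.not_injective_iff.1 h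
    have hs : g b ∈ Finset.univ.image g := Finset.mem_image_of_mem _ (Finset.mem_univ _)
    refine lt_of_lt_of_le ?_ (Finset.single_le_sum hnn hs)
    have h2 : 1 < n (g b) := Finset.one_lt_card.2 ⟨a, by simp [hab], b, by simp, hne⟩
    have h2' : (1 : ℝ) < n (g b) := by exact_mod_cast h2
    exact mul_pos (by positivity) (Real.logb_pos hq1 h2')

namespace BlockCode

variable {F B : Type*} {M c α : ℕ}

/-- A file that is determined by `kc` nodes of each block of `S` has at most `|S| * kc * α`
symbols. -/
theorem fileSize_le_of_injective_observe [Field F] [Fintype F] [Fintype B]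
    (C : BlockCode F M B c α) {kc : ℕ} {S : Finset B} {A : B → Finset (Fin c)}
    (hA : ∀ i ∈ S, (A i).card = kc) (h : Function.Injective (C.observe S A)) :
    M ≤ S.card * kc * α := by
  have hle := Nat.card_le_card_of_injective _ h
  rw [Nat.card_fun, Nat.card_fun, Nat.card_fun, card_observed S A hA] at hle
  simp only [Nat.card_eq_fintype_card, Fintype.card_fin] at hle
  rw [← pow_mul, Nat.pow_le_pow_iff_right Fintype.one_lt_card] at hle
  linarith [Nat.mul_comm α (S.card * kc)]

variable [Fintype F] [Fintype B]

/-- The numbers of blocks whose content may fail to determine the file are bounded. -/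
theorem bddAbove_undetermined (C : BlockCode F M B c α) (kc : ℕ) :
    BddAbove {s : ℕ | ∃ (S : Finset B) (A : B → Finset (Fin c)), S.card = s ∧
      (∀ i ∈ S, (A i).card = kc) ∧ qEntropy (Fintype.card F) (C.observe S A) < M} := by
  refine ⟨Fintype.card B, ?_⟩
  rintro s ⟨S, A, rfl, -⟩
  exact S.card_le_univ

/-- An undetermined choice on `b - ρ` blocks would push the supremum up to `b - ρ` and the
resilience below `ρ`. -/
theorem injective_observe_of_le_resilience [Field F] (C : BlockCode F M B c α) {kc ρ : ℕ}
    (h : (ρ : ℤ) ≤ C.resilience kc) {S : Finset B} {A : B → Finset (Fin c)}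
    (hS : S.card = Fintype.card B - ρ) (hA : ∀ i ∈ S, (A i).card = kc) :
    Function.Injective (C.observe S A) := by
  by_contra hinj
  have := le_csSup (C.bddAbove_undetermined kc)
    ⟨S, A, rfl, hA, (qEntropy_lt_iff_not_injective _).2 hinj⟩
  unfold resilience at h
  omega

theorem lt_card_of_le_resilience (C : BlockCode F M B c α) {kc ρ : ℕ}
    (h : (ρ : ℤ) ≤ C.resilience kc) : ρ < Fintype.card B := by
  unfold resilience at h
  omega

/-- The resilience of a code whose file is determined by `kc` nodes of each of any `b - ρ` blocks, but
not by fewer blocks. -/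
theorem IsBFR.resilience_eq [Field F] {C : BlockCode F M B c α} {kc ρ : ℕ} (h : C.IsBFR kc ρ)
    (hlt : (Fintype.card B - ρ - 1) * kc * α < M) : C.resilience kc = ρ := by
  obtain ⟨hρ, hkc, hdec⟩ := h
  have hsup : sSup {s : ℕ | ∃ (S : Finset B) (A : B → Finset (Fin c)), S.card = s ∧
      (∀ i ∈ S, (A i).card = kc) ∧ qEntropy (Fintype.card F) (C.observe S A) < M} =
      Fintype.card B - ρ - 1 := by
    refine IsGreatest.csSup_eq ⟨?_, ?_⟩
    -- Any `b - ρ - 1` blocks fail, since by `hlt` they hold too few symbols.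
    · obtain ⟨S, hS⟩ := Finset.exists_subset_card_eq (s := (Finset.univ : Finset B))
        (n := Fintype.card B - ρ - 1) (by rw [Finset.card_univ]; omega)
      obtain ⟨A, hA⟩ := Finset.exists_subset_card_eq (s := (Finset.univ : Finset (Fin c)))
        (n := kc) (by simpa using hkc)
      refine ⟨S, fun _ => A, hS.2, fun _ _ => hA.2, ?_⟩
      rw [qEntropy_lt_iff_not_injective]
      intro hinj
      have := C.fileSize_le_of_injective_observe (fun _ _ => hA.2) hinj
      rw [hS.2] at this
      omega
    -- A larger set of blocks contains `b - ρ` blocks that already decode.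
    · rintro s ⟨S, A, rfl, hA, hent⟩
      rw [qEntropy_lt_iff_not_injective] at hent
      by_contra hgt
      obtain ⟨T, hTS, hT⟩ := Finset.exists_subset_card_eq (s := S)
        (n := Fintype.card B - ρ) (by omega)
      refine hent fun f f' hff => hdec T A hT (fun i hi => hA i (hTS hi)) ?_
      funext x
      exact congrFun hff ⟨x.1, hTS x.2.1, x.2.2⟩
  unfold resilience
  rw [hsup]
  omega

end BlockCode

/-! ### The file size bound -/

/-- If the local data size is `KL = bL * s`, the bound is `(b - ρ) * s`. -/
theorem fileSizeBound_eq {b bL s ρ : ℕ} (hbL : 0 < bL) :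
    fileSizeBound b bL (bL * s) ρ = (((b - ρ) * s : ℕ) : ℚ) := by
  have hb : (bL : ℚ) ≠ 0 := by positivity
  have hdm : (((b - ρ : ℕ) : ℚ)) = bL * (((b - ρ) / bL : ℕ) : ℚ) + (((b - ρ) % bL : ℕ) : ℚ) := by
    exact_mod_cast (Nat.div_add_mod (b - ρ) bL).symm
  unfold fileSizeBound
  rw [Nat.cast_mul (b - ρ), hdm]
  push_cast
  field_simp

/-- The file size bound for locally repairable codes with minimum-storage local codes. -/
theorem BlockCode.IsMinStorageLRC.fileSize_le {F : Type*} [Field F] [Fintype F]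
    {M g bL c α KL kc dr σ β ρ : ℕ} {C : BlockCode F M (Fin g × Fin bL) c α}
    (h : C.IsMinStorageLRC KL kc 0 dr σ β) (hρ : (ρ : ℤ) ≤ C.resilience kc) :
    (M : ℚ) ≤ fileSizeBound (g * bL) bL KL ρ := by
  have hlt := C.lt_card_of_le_resilience hρ
  have hcard : Fintype.card (Fin g × Fin bL) = g * bL := by simp
  have hpos : 0 < g * bL := by omega
  have hg : 0 < g := Nat.pos_of_mul_pos_right hpos
  have hbL : 0 < bL := Nat.pos_of_mul_pos_left hpos
  obtain ⟨E, -, ⟨⟨-, hkc, -⟩, -⟩, hKL⟩ := h ⟨0, hg⟩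
  obtain ⟨S, -, hS⟩ := Finset.exists_subset_card_eq
    (s := (Finset.univ : Finset (Fin g × Fin bL))) (n := Fintype.card (Fin g × Fin bL) - ρ)
    (by rw [Finset.card_univ]; omega)
  obtain ⟨A, -, hA⟩ := Finset.exists_subset_card_eq (s := (Finset.univ : Finset (Fin c)))
    (n := kc) (by simpa using hkc)
  have hinj := C.injective_observe_of_le_resilience (A := fun _ => A) hρ hS fun _ _ => hA
  have hle := C.fileSize_le_of_injective_observe (fun _ _ => hA) hinj
  rw [Fintype.card_fin, Nat.sub_zero, mul_assoc] at hKL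
  rw [hKL, fileSizeBound_eq hbL]
  rw [hS, hcard, mul_assoc] at hle
  exact_mod_cast hle

/-! ### Linearized polynomials: uniqueness and interpolation -/

section Gabidulin

variable {K L : Type*} [Field K] [Fintype K] [Field L] [Algebra K L]

/-- Evaluation of a linearized polynomial, as a linear map over the small field. -/
noncomputable def linearizedMap (K : Type*) {L : Type*} [Field K] [Fintype K] [Field L] [Algebra K L]
    {M : ℕ} (f : Fin M → L) : L →ₗ[K] L :=
  ∑ i : Fin M, f i • ((FiniteField.frobeniusAlgHom K L) ^ (i : ℕ)).toLinearMap

theorem frobeniusAlgHom_pow_apply (n : ℕ) (x : L) :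
    ((FiniteField.frobeniusAlgHom K L) ^ n) x = x ^ Fintype.card K ^ n := by
  induction n with
  | zero => simp
  | succ n ih =>
    rw [pow_succ', AlgHom.mul_apply, ih, FiniteField.coe_frobeniusAlgHom, pow_succ, pow_mul]

theorem linearizedMap_apply {M : ℕ} (f : Fin M → L) (x : L) :
    linearizedMap K f x = ∑ i : Fin M, f i * x ^ Fintype.card K ^ (i : ℕ) := by
  simp [linearizedMap, LinearMap.sum_apply, frobeniusAlgHom_pow_apply]

theorem gabidulin_eq_linearizedMap {M N : ℕ} (y : Fin N → L) (f : Fin M → L) (n : Fin N) :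
    gabidulin (Fintype.card K) y f n = linearizedMap K f (y n) := by
  rw [linearizedMap_apply, gabidulin]

theorem linearizedMap_sub {M : ℕ} (f f' : Fin M → L) (x : L) :
    linearizedMap K (f - f') x = linearizedMap K f x - linearizedMap K f' x := by
  simp [linearizedMap_apply, sub_mul, Finset.sum_sub_distrib]

/-- A linearized polynomial with `M` coefficients that vanishes at `M` points which are independent
over the small field is zero. -/
theorem eq_zero_of_linearizedMap_eq_zero {M : ℕ} {ι : Type*} [Fintype ι] {z : ι → L}
    (hz : LinearIndependent K z) (hM : M ≤ Fintype.card ι) {f : Fin M → L}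
    (h : ∀ i, linearizedMap K f (z i) = 0) : f = 0 := by
  classical
  by_contra hf
  obtain ⟨i₀, hi₀⟩ := Function.ne_iff.1 hf
  set q := Fintype.card K with hq
  have hq1 : 1 < q := Fintype.one_lt_card
  set P : Polynomial L := ∑ i : Fin M, Polynomial.C (f i) * Polynomial.X ^ q ^ (i : ℕ) with hP
  have hcoeff : P.coeff (q ^ (i₀ : ℕ)) = f i₀ := by
    rw [hP, Polynomial.finsetSum_coeff, Finset.sum_eq_single i₀]
    · simp
    · intro i _ hi
      rw [Polynomial.coeff_C_mul_X_pow, if_neg]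
      intro h'
      exact hi (Fin.ext (Nat.pow_right_injective hq1 h').symm)
    · simp
  have hP0 : P ≠ 0 := by
    intro h0
    rw [h0, Polynomial.coeff_zero] at hcoeff
    exact hi₀ hcoeff.symm
  -- The roots contain the span of the points, which has at least `q ^ M` elements, while the degree
  -- is at most `q ^ (M - 1)`.
  have hdeg : P.natDegree ≤ q ^ (M - 1) := by
    refine Polynomial.natDegree_sum_le_of_forall_le _ _ fun i _ => ?_
    refine (Polynomial.natDegree_C_mul_X_pow_le _ _).trans ?_
    exact Nat.pow_le_pow_right hq1.le (by omega)
  have heval : ∀ x, P.eval x = linearizedMap K f x := by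
    intro x
    simp [hP, linearizedMap_apply, Polynomial.eval_finsetSum, hq]
  have hinj : Function.Injective fun a : ι → K => ∑ i, a i • z i := by
    intro a a' haa
    have := Fintype.linearIndependent_iff.1 hz (a - a') (by
      simpa [sub_smul, Finset.sum_sub_distrib, sub_eq_zero] using haa)
    funext i
    simpa [sub_eq_zero] using this i
  have hle : (Finset.univ.image fun a : ι → K => ∑ i, a i • z i).card ≤ P.roots.toFinset.card := by
    refine Finset.card_le_card fun x hx => ?_
    obtain ⟨a, -, rfl⟩ := Finset.mem_image.1 hx
    rw [Multiset.mem_toFinset, Polynomial.mem_roots hP0, Polynomial.IsRoot, heval, map_sum]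
    exact Finset.sum_eq_zero fun i _ => by rw [map_smul, h i, smul_zero]
  rw [Finset.card_image_of_injective _ hinj, Finset.card_univ, Fintype.card_fun] at hle
  have h3 := hle.trans ((Multiset.toFinset_card_le _).trans ((Polynomial.card_roots' P).trans hdeg))
  rw [Nat.pow_le_pow_iff_right hq1] at h3
  have := i₀.2
  omega

/-- Interpolation by linearized polynomials. -/
theorem exists_linearizedMap_eq [Finite L] {M : ℕ} {ι : Type*} [Fintype ι] {z : ι → L}
    (hz : LinearIndependent K z) (hM : Fintype.card ι ≤ M) (x : ι → L) :
    ∃ f : Fin M → L, ∀ i, linearizedMap K f (z i) = x i := by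
  have := Fintype.ofFinite L
  have hinj : Function.Injective fun (f : Fin (Fintype.card ι) → L) i => linearizedMap K f (z i) := by
    intro f f' hff
    refine sub_eq_zero.1 (eq_zero_of_linearizedMap_eq_zero hz le_rfl fun i => ?_)
    rw [linearizedMap_sub, sub_eq_zero]
    exact congrFun hff i
  classical
  -- With as many coefficients as points, uniqueness gives existence by finiteness; the remaining
  -- coefficients are then set to zero.
  have hbij := (Fintype.bijective_iff_injective_and_card _).2 ⟨hinj, by simp⟩
  obtain ⟨f, hf⟩ := hbij.2 x
  refine ⟨fun i => if hi : (i : ℕ) < Fintype.card ι then f ⟨i, hi⟩ else 0, fun i => ?_⟩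
  rw [← congrFun hf i]
  simp only [linearizedMap_apply]
  obtain ⟨e, he⟩ := Nat.exists_eq_add_of_le hM
  subst he
  rw [Fin.sum_univ_add]
  simp

end Gabidulin

/-! ### The local code: decoding and repair -/

section LocalCode

variable {K L L' : Type*} [Field K] [Field L] [Algebra K L] [Field L'] [Algebra K L']

theorem linearEncode_map (φ : L →ₗ[K] L') {M n α : ℕ} (G : Fin n → Matrix (Fin α) (Fin M) K)
    (x : Fin M → L) (i : Fin n) (s : Fin α) :
    linearEncode L' G (fun t => φ (x t)) i s = φ (linearEncode L G x i s) := by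
  simp [linearEncode, map_sum]

/-- The entries of `G` lie in `K`. This is used both to pull linearized polynomials out of the
encoder and to push functionals `L → K` through it. -/
theorem dcbdCode_map (φ : L →ₗ[K] L') {b r c KL α m n' α' : ℕ} (lay : DCBDLayout b r c KL α m n' α')
    (G : Fin n' → Matrix (Fin α') (Fin m) K) (x : Fin KL → L) (l : Fin b) (j : Fin c) (s : Fin α) :
    dcbdCode L' lay G (fun t => φ (x t)) l j s = φ (dcbdCode L lay G x l j s) :=
  linearEncode_map φ G _ _ _

/-- A linear minimum storage regenerating code remains one over a finite extension field. -/
theorem IsMSR.extendScalars [FiniteDimensional K L] {M n α k d β : ℕ}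
    {G : Fin n → Matrix (Fin α) (Fin M) K} (h : IsMSR (linearEncode K G) k d β) :
    IsMSR (linearEncode L G) k d β := by
  obtain ⟨⟨hkd, hdn, hdec, hrep⟩, hM, hα⟩ := h
  -- In coordinates over `K` the code over `L` is a tuple of codewords of the code over `K`, so
  -- decoding and repair run in each coordinate. The coordinates of a repair message are reassembled
  -- into `β` symbols of `L`.
  let e := Module.finBasis K L
  refine ⟨⟨hkd, hdn, fun A hA f f' hff => ?_, fun i A hi hA => ?_⟩, hM, hα⟩
  · have key : ∀ a, (fun t => e.coord a (f t)) = fun t => e.coord a (f' t) := by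
      intro a
      refine hdec A hA ?_
      funext x s
      change linearEncode K G (fun t => e.coord a (f t)) x s =
        linearEncode K G (fun t => e.coord a (f' t)) x s
      rw [linearEncode_map, linearEncode_map]
      exact congrArg _ (congrFun (congrFun hff x) s)
    funext t
    exact e.ext_elem fun a => congrFun (key a) t
  · obtain ⟨h, hh⟩ := hrep i A hi hA
    refine ⟨fun j v s => ∑ a, h j (fun u => e.coord a (v u)) s • e a, fun f f' hff => ?_⟩
    have key : ∀ a, linearEncode K G (fun t => e.coord a (f t)) i =
        linearEncode K G (fun t => e.coord a (f' t)) i := by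
      intro a
      refine hh _ _ fun j hj => ?_
      funext s
      have h1 := congrArg (e.coord a) (congrFun (hff j hj) s)
      simp only [map_sum, map_smul, Module.Basis.coord_apply, Module.Basis.repr_self,
        Finsupp.single_apply, smul_eq_mul, mul_ite, mul_one, mul_zero, Finset.sum_ite_eq',
        Finset.mem_univ, if_true] at h1
      simpa only [← linearEncode_map, ← Module.Basis.coord_apply] using h1
    funext s
    refine e.ext_elem fun a => ?_
    have := congrFun (key a) s
    rwa [linearEncode_map, linearEncode_map] at this

theorem mem_dcbdRow {r v : ℕ} {l : Fin v} {p : Fin r × Fin v} : p ∈ dcbdRow r l ↔ p.2 ≠ l := by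
  simp [dcbdRow, dcbdBlock]

namespace DCBDLayout

variable {b r c KL α m n' α' : ℕ}

theorem dataSize_eq (lay : DCBDLayout b r c KL α m n' α') : KL = r * b * m := by
  simpa using Fintype.card_congr lay.split

theorem storage_eq (lay : DCBDLayout b r c KL α m n' α') (hb : 0 < b) : α = r * (b - 1) * α' := by
  classical
  have h := Fintype.card_congr (lay.store ⟨0, hb⟩)
  rw [Fintype.card_prod, Fintype.card_fin, Fintype.card_fin, Fintype.card_coe] at h
  rw [← h]
  simp [dcbdRow, dcbdBlock]

theorem length_eq (lay : DCBDLayout b r c KL α m n' α') (hb : 0 < b) (hr : 0 < r) :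
    n' = (b - 1) * c := by
  classical
  have h := Fintype.card_congr (lay.place (⟨0, hr⟩, ⟨0, hb⟩))
  rw [Fintype.card_prod, Fintype.card_fin, Fintype.card_fin] at h
  rw [← h, Fintype.card_subtype]
  simp only [mem_dcbdRow]
  rw [Finset.filter_ne, Finset.card_erase_of_mem (Finset.mem_univ _), Finset.card_univ,
    Fintype.card_fin]

open Classical in
/-- The indices of the codeword symbols of the part `p` that are stored at the nodes `A l` of the
blocks `l ∈ T`. -/
noncomputable def nodes (lay : DCBDLayout b r c KL α m n' α') (p : Fin r × Fin b)
    (T : Finset (Fin b)) (A : Fin b → Finset (Fin c)) : Finset (Fin n') :=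
  Finset.univ.filter fun n =>
    ((lay.place p).symm n).1.1 ∈ T ∧ ((lay.place p).symm n).2 ∈ A ((lay.place p).symm n).1.1

theorem mem_nodes (lay : DCBDLayout b r c KL α m n' α') {p : Fin r × Fin b}
    {T : Finset (Fin b)} {A : Fin b → Finset (Fin c)} (x : {l : Fin b // p ∈ dcbdRow r l} × Fin c) :
    lay.place p x ∈ lay.nodes p T A ↔ x.1.1 ∈ T ∧ x.2 ∈ A x.1.1 := by
  simp [nodes]

theorem card_nodes (lay : DCBDLayout b r c KL α m n' α') {p : Fin r × Fin b}
    {T : Finset (Fin b)} {A : Fin b → Finset (Fin c)} {k : ℕ} (hp : p.2 ∉ T)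
    (hA : ∀ l ∈ T, (A l).card = k) : (lay.nodes p T A).card = T.card * k := by
  classical
  rw [← Finset.sum_const_nat hA, ← Finset.card_sigma]
  have hT : ∀ l ∈ T, p ∈ dcbdRow r l := fun l hl => mem_dcbdRow.2 fun h => hp (h ▸ hl)
  refine (Finset.card_bij' (fun (x : Σ _ : Fin b, Fin c) hx =>
    lay.place p (⟨x.1, hT _ (Finset.mem_sigma.1 hx).1⟩, x.2))
    (fun n _ => ⟨((lay.place p).symm n).1.1, ((lay.place p).symm n).2⟩) ?_ ?_ ?_ ?_).symm
  · intro x hx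
    rw [mem_nodes]
    exact Finset.mem_sigma.1 hx
  · intro n hn
    rw [Finset.mem_sigma]
    simpa [nodes] using hn
  · intro x hx
    simp
  · intro n hn
    simp

end DCBDLayout

variable {b r c KL α m n' α' : ℕ}

/-- The symbols that block `l` stores for the part `p`. -/
theorem dcbdCode_store (lay : DCBDLayout b r c KL α m n' α') (G : Fin n' → Matrix (Fin α') (Fin m) K)
    (x : Fin KL → L) {l : Fin b} (j : Fin c) {p : Fin r × Fin b} (hp : p ∈ dcbdRow r l)
    (s : Fin α') :
    dcbdCode L lay G x l j (lay.store l (⟨p, hp⟩, s)) =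
      linearEncode L G (fun t => x (lay.split.symm (p, t))) (lay.place p (⟨l, hp⟩, j)) s := by
  -- Generalizing the inverse image avoids rewriting inside terms that depend on its membership
  -- proof.
  have key : ∀ pa, (lay.store l).symm (lay.store l (⟨p, hp⟩, s)) = pa →
      dcbdCode L lay G x l j (lay.store l (⟨p, hp⟩, s)) =
        linearEncode L G (fun t => x (lay.split.symm (pa.1.1, t)))
          (lay.place pa.1.1 (⟨l, pa.1.2⟩, j)) pa.2 := by
    rintro pa rfl
    rfl
  exact key _ (Equiv.symm_apply_apply _ _)

/-- The part `p` is missing only from block `p.2`, so the nodes read hold `(b - 1) * kc` of its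
codeword symbols, the reconstruction degree of the MSR code. -/
theorem dcbdCode_isBFR (lay : DCBDLayout b r c KL α m n' α') (G : Fin n' → Matrix (Fin α') (Fin m) K)
    {kc d β : ℕ} (hb : 1 < b) (hr : 0 < r) (hG : IsMSR (linearEncode L G) ((b - 1) * kc) d β) :
    (dcbdCode L lay G).IsBFR kc 0 := by
  obtain ⟨⟨hkd, hdn, hdec, -⟩, -⟩ := hG
  refine ⟨by simpa using (by omega : 0 < b), ?_, ?_⟩
  · rw [lay.length_eq (by omega) hr] at hdn
    exact (Nat.lt_of_mul_lt_mul_left (hkd.trans_lt hdn)).le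
  · intro S A hS hA f f' hff
    have hSu : S = Finset.univ := by
      rw [← Finset.card_eq_iff_eq_univ, hS, Nat.sub_zero]
    have key : ∀ p, (fun t => f (lay.split.symm (p, t))) = fun t => f' (lay.split.symm (p, t)) := by
      intro p
      have hcard := lay.card_nodes (p := p) (T := Finset.univ.erase p.2) (A := A) (k := kc)
        (by simp) fun l _ => hA l (by simp [hSu])
      rw [Finset.card_erase_of_mem (Finset.mem_univ _), Finset.card_univ, Fintype.card_fin] at hcard
      refine hdec _ hcard ?_
      funext ⟨n, hn⟩ s
      obtain ⟨⟨⟨l, hl⟩, j⟩, rfl⟩ := (lay.place p).surjective n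
      rw [lay.mem_nodes] at hn
      have h1 := congrFun (congrFun hff ⟨(l, j), by simp [hSu], hn.2⟩) (lay.store l (⟨p, hl⟩, s))
      simpa only [BlockCode.observe, dcbdCode_store] using h1
    funext u
    obtain ⟨⟨p, t⟩, rfl⟩ := lay.split.symm.surjective u
    exact congrFun (key p) t

open Classical in
/-- The block that does not help to repair the part `p`, when the blocks of `S` help. -/
noncomputable def idleHelper {S : Finset (Fin b)} (e : Fin r ≃ S) (p : Fin r × Fin b) : Fin b :=
  if p.2 ∈ S then p.2 else (e p.1).1

theorem idleHelper_mem {S : Finset (Fin b)} (e : Fin r ≃ S) (p : Fin r × Fin b) :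
    idleHelper e p ∈ S := by
  unfold idleHelper
  split_ifs with h
  · exact h
  · exact (e p.1).2

theorem notMem_erase_idleHelper {S : Finset (Fin b)} (e : Fin r ≃ S) (p : Fin r × Fin b) :
    p.2 ∉ S.erase (idleHelper e p) := by
  unfold idleHelper
  split_ifs with h
  · simp
  · exact fun hmem => h (Finset.mem_of_mem_erase hmem)

/-- The number of parts of block `i` for which the helper block `l` sends repair data. -/
theorem card_active_le {S : Finset (Fin b)} (e : Fin r ≃ S) {i l : Fin b} (hi : i ∉ S) (hl : l ∈ S) :
    Nat.card {p : Fin r × Fin b // p.2 ≠ i ∧ idleHelper e p ≠ l} ≤ (r - 1) * (b - 1) := by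
  classical
  rw [Nat.card_eq_fintype_card, Fintype.card_subtype]
  have htot : (Finset.univ.filter fun p : Fin r × Fin b => p.2 ≠ i).card = r * (b - 1) := by
    have : (Finset.univ.filter fun p : Fin r × Fin b => p.2 ≠ i) =
        Finset.univ ×ˢ Finset.univ.erase i := by
      ext p
      simp
    rw [this, Finset.card_product, Finset.card_erase_of_mem (Finset.mem_univ _)]
    simp
  have hsplit := Finset.card_filter_add_card_filter_not
    (s := Finset.univ.filter fun p : Fin r × Fin b => p.2 ≠ i) (fun p => idleHelper e p ≠ l)
  rw [Finset.filter_filter, htot] at hsplit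
  have hidle : b - 1 ≤ (Finset.filter (fun p : Fin r × Fin b => ¬ idleHelper e p ≠ l)
      (Finset.univ.filter fun p : Fin r × Fin b => p.2 ≠ i)).card := by
    have hc : ((Finset.univ : Finset (Fin b)).erase i).card = b - 1 := by
      rw [Finset.card_erase_of_mem (Finset.mem_univ _), Finset.card_univ, Fintype.card_fin]
    rw [← hc]
    -- Block `l` is idle for the parts `(t, l)`, all `r` of them, and for the parts `(e.symm l, j)`
    -- with `j ∉ S`, `j ≠ i`. The injection lists both kinds by the `b - 1` indices different from
    -- `i`.
    refine Finset.card_le_card_of_injOn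
      (fun j => if hj : j ∈ S then (e.symm ⟨j, hj⟩, l) else (e.symm ⟨l, hl⟩, j)) ?_ ?_
    · intro j hj
      have hji : j ≠ i := by simpa using hj
      by_cases hjS : j ∈ S
      · have hli : l ≠ i := fun h => hi (h ▸ hl)
        simp [hjS, idleHelper, hl, hli]
      · simp [hjS, idleHelper, hji]
    · intro j _ j' _ hjj
      by_cases hjS : j ∈ S <;> by_cases hjS' : j' ∈ S <;> simp [hjS, hjS'] at hjj
      · exact hjj
      · exact absurd (hjj.2 ▸ hl) hjS'
      · exact absurd (hjj.2 ▸ hl) hjS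
      · exact hjj
  rw [Nat.sub_one_mul]
  omega

/-- Of the `r = b - σ` helper blocks, `r - 1` repair each part, which matches the repair degree `(r
- 1) * dr`. Balancing the idle blocks leaves each helper at most `(r - 1) * (b - 1)` parts to serve,
with `β` symbols each. -/
theorem dcbdCode_isMinStorage (lay : DCBDLayout b r c KL α m n' α')
    (G : Fin n' → Matrix (Fin α') (Fin m) K) [Finite L]
    {kc dr σ β : ℕ} (hr : r = b - σ) (hσ : σ < b - 1) (hdr : dr ≤ c)
    (hG : IsMSR (linearEncode L G) ((b - 1) * kc) ((b - σ - 1) * dr) β) :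
    (dcbdCode L lay G).IsMinStorage kc 0 dr σ ((b - σ - 1) * (b - 1) * β) := by
  classical
  have := Fintype.ofFinite L
  rw [← hr] at hG ⊢
  refine ⟨⟨dcbdCode_isBFR lay G (by omega) (by omega) hG, by simp; omega, hdr, ?_⟩, ?_⟩
  · intro i j S A hi hS hA
    rw [Fintype.card_fin, ← hr] at hS
    let e : Fin r ≃ S := (Fin.castOrderIso hS.symm).toEquiv.trans S.equivFin.symm
    have hrep : ∀ p : Fin r × Fin b, p ∈ dcbdRow r i →
        ∃ h : Fin n' → (Fin α' → L) → (Fin β → L), ∀ f f' : Fin m → L,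
          (∀ n ∈ lay.nodes p (S.erase (idleHelper e p)) A,
            h n (linearEncode L G f n) = h n (linearEncode L G f' n)) →
          ∀ hp : p ∈ dcbdRow r i,
            linearEncode L G f (lay.place p (⟨i, hp⟩, j)) =
              linearEncode L G f' (lay.place p (⟨i, hp⟩, j)) := by
      intro p hp
      have hcard := lay.card_nodes (A := A) (k := dr) (notMem_erase_idleHelper e p)
        fun l hl => hA l (Finset.mem_of_mem_erase hl)
      rw [Finset.card_erase_of_mem (idleHelper_mem e p), hS] at hcard
      obtain ⟨h, hh⟩ := hG.1.2.2.2 (lay.place p (⟨i, hp⟩, j)) _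
        (fun hmem => hi (Finset.mem_of_mem_erase ((lay.mem_nodes _).1 hmem).1)) hcard
      exact ⟨h, fun f f' hff _ => hh f f' hff⟩
    choose! h hh using hrep
    -- The messages for all active parts are packed into one message; a comparison of cardinalities
    -- suffices, as only injectivity matters.
    have henc : ∀ l ∈ S, ∃ ψ : ({p : Fin r × Fin b // p.2 ≠ i ∧ idleHelper e p ≠ l} → Fin β → L) →
        (Fin ((r - 1) * (b - 1) * β) → L), Function.Injective ψ := by
      intro l hl
      have hcard := card_active_le e hi hl
      rw [Nat.card_eq_fintype_card] at hcard
      have : Nonempty (({p : Fin r × Fin b // p.2 ≠ i ∧ idleHelper e p ≠ l} → Fin β → L) ↪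
          (Fin ((r - 1) * (b - 1) * β) → L)) := by
        refine Function.Embedding.nonempty_of_card_le ?_
        rw [Fintype.card_fun, Fintype.card_fun, Fintype.card_fun, Fintype.card_fin,
          Fintype.card_fin, ← pow_mul, mul_comm β]
        exact Nat.pow_le_pow_right Fintype.card_pos (Nat.mul_le_mul_right _ hcard)
      exact this.elim fun ψ => ⟨ψ, ψ.injective⟩
    choose! ψ hψ using henc
    -- The default `0` never occurs for `l ∈ S`: a helper that does not store a part is the idle one
    -- for it.
    refine ⟨fun l u v => ψ l fun p s => if hp : p.1 ∈ dcbdRow r l then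
      h p.1 (lay.place p.1 (⟨l, hp⟩, u)) (fun s' => v (lay.store l (⟨p.1, hp⟩, s'))) s else 0,
      fun f f' hff => ?_⟩
    funext s
    obtain ⟨⟨⟨p, hp⟩, s⟩, rfl⟩ := (lay.store i).surjective s
    rw [dcbdCode_store, dcbdCode_store]
    refine congrFun (hh p hp _ _ ?_ hp) s
    intro n hn
    obtain ⟨⟨⟨l, hl⟩, u⟩, rfl⟩ := (lay.place p).surjective n
    obtain ⟨hlS, hu⟩ := (lay.mem_nodes _).1 hn
    obtain ⟨hlo, hlS⟩ := Finset.mem_erase.1 hlS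
    have h1 := congrFun (hψ l hlS (hff l hlS u hu)) ⟨p, mem_dcbdRow.1 hp, hlo.symm⟩
    simpa only [hl, dif_pos, dcbdCode_store] using h1
  · rw [Fintype.card_fin, Nat.sub_zero, lay.dataSize_eq, hG.2.1, lay.storage_eq (by omega)]
    ring

end LocalCode

/-! ### The cut-set bound and the BFR-MSR case -/

namespace BlockCode

/-- In a minimum-storage code without block failures, the contents of `kc` nodes of each block are
arbitrary. -/
theorem IsBFR.exists_file {F B : Type*} [Finite F] [Fintype B] {M c α kc : ℕ}
    {C : BlockCode F M B c α} (h : C.IsBFR kc 0) (hM : M = Fintype.card B * kc * α)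
    {A : B → Finset (Fin c)} (hA : ∀ i, (A i).card = kc) (w : B → Fin c → Fin α → F) :
    ∃ f, ∀ i, ∀ j ∈ A i, C f i j = w i j := by
  classical
  have := Fintype.ofFinite F
  have hinj := h.2.2 Finset.univ A (by simp) fun i _ => hA i
  have hcard := card_observed Finset.univ A fun i _ => hA i
  rw [Nat.card_eq_fintype_card, Finset.card_univ] at hcard
  have hbij := (Fintype.bijective_iff_injective_and_card _).2 ⟨hinj, by
    rw [Fintype.card_fun, Fintype.card_fun, Fintype.card_fun, Fintype.card_fin, Fintype.card_fin,
      hcard, ← pow_mul, hM, mul_comm α]⟩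
  obtain ⟨f, hf⟩ := hbij.2 fun x => w x.1.1 x.1.2
  exact ⟨f, fun i j hj => congrFun hf ⟨(i, j), Finset.mem_univ _, hj⟩⟩

/-- The cut-set bound on the repair traffic of a minimum-storage code when one node per block is
read and all other blocks help in a repair. -/
theorem IsBFRRC.storage_le {F B : Type*} [Field F] [Fintype F] [Fintype B] {M c α dr β : ℕ}
    {C : BlockCode F M B c α} (h : C.IsBFRRC 1 0 dr 1 β) (hM : M = Fintype.card B * 1 * α)
    (hdr : 0 < dr) : α ≤ (Fintype.card B - 1) * (dr - 1) * β := by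
  classical
  obtain ⟨hBFR, hB, hdrc, hrep⟩ := h
  obtain ⟨i⟩ : Nonempty B := Fintype.card_pos_iff.1 (by omega)
  let j : Fin c := ⟨0, by omega⟩
  obtain ⟨A, hjA, -, hA⟩ := Finset.exists_subsuperset_card_eq (s := {j})
    (t := (Finset.univ : Finset (Fin c))) (n := dr) (Finset.subset_univ _)
    (by rw [Finset.card_singleton]; exact hdr) (by simpa using hdrc)
  have hj : j ∈ A := hjA (Finset.mem_singleton_self j)
  obtain ⟨h, hh⟩ := hrep i j (Finset.univ.erase i) (fun _ => A) (Finset.notMem_erase _ _)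
    (by rw [Finset.card_erase_of_mem (Finset.mem_univ _), Finset.card_univ]) fun _ _ => hA
  -- Node `j` of block `i` is arbitrary while node `j` of every other block is zero. Those nodes
  -- help but send constants, so only `dr - 1` helpers per block carry information about `v`.
  have hfile : ∀ v : Fin α → F, ∃ f, C f i j = v ∧ ∀ l, l ≠ i → C f l j = 0 := by
    intro v
    obtain ⟨f, hf⟩ := hBFR.exists_file hM (A := fun _ => {j}) (fun _ => Finset.card_singleton j)
      fun l _ => if l = i then v else 0
    exact ⟨f, by simpa using hf i j (Finset.mem_singleton_self j), fun l hl => by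
      simpa [hl] using hf l j (Finset.mem_singleton_self j)⟩
  choose f hfi hfl using hfile
  have hinj : Function.Injective fun (v : Fin α → F)
      (x : {l // l ∈ Finset.univ.erase i} × {u // u ∈ A.erase j}) => h x.1 x.2 (C (f v) x.1 x.2) := by
    intro v v' hvv
    rw [← hfi v, ← hfi v']
    refine hh _ _ fun l hl u hu => ?_
    by_cases huj : u = j
    · have hli := Finset.ne_of_mem_erase hl
      rw [huj, hfl v l hli, hfl v' l hli]
    · exact congrFun hvv (⟨l, hl⟩, ⟨u, Finset.mem_erase.2 ⟨huj, hu⟩⟩)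
  have hle := Fintype.card_le_of_injective _ hinj
  rw [Fintype.card_fun, Fintype.card_fun, Fintype.card_fun, Fintype.card_prod, Fintype.card_coe,
    Fintype.card_coe, Finset.card_erase_of_mem (Finset.mem_univ _), Finset.card_erase_of_mem hj,
    Finset.card_univ, hA, Fintype.card_fin, Fintype.card_fin, ← pow_mul,
    Nat.pow_le_pow_iff_right Fintype.one_lt_card] at hle
  linarith [Nat.mul_comm β ((Fintype.card B - 1) * (dr - 1))]

end BlockCode

/-- If one node per block is read and one block may fail to help, the local code has the least
repair bandwidth. -/
theorem dcbdCode_isBFRMSR {K L : Type*} [Field K] [Field L] [Algebra K L] [Finite L]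
    {b r c KL α m n' α' dr β : ℕ} (lay : DCBDLayout b r c KL α m n' α')
    (G : Fin n' → Matrix (Fin α') (Fin m) K) (hr : r = b - 1) (hb : 1 < b - 1) (hdr : dr ≤ c)
    (hG : IsMSR (linearEncode L G) ((b - 1) * 1) ((b - 1 - 1) * dr) β) :
    (dcbdCode L lay G).IsBFRMSR 1 0 dr 1 ((b - 1 - 1) * (b - 1) * β) := by
  have hmin := dcbdCode_isMinStorage lay G hr hb hdr hG
  refine ⟨hmin, fun F' _ _ C' β' hC' => ?_⟩
  have hkd := hG.1.1
  have hdr0 : 0 < dr := by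
    rcases Nat.eq_zero_or_pos dr with rfl | h
    · omega
    · exact h
  have hle := hC'.storage_le hmin.2 hdr0
  have hα' := hG.2.2
  rw [Fintype.card_fin, lay.storage_eq (by omega), hα', hr] at hle
  obtain ⟨e, rfl⟩ : ∃ e, b = e + 2 := ⟨b - 2, by omega⟩
  obtain ⟨x, rfl⟩ : ∃ x, dr = x + 1 := ⟨dr - 1, by omega⟩
  simp only [show e + 2 - 1 = e + 1 by omega, Nat.add_sub_cancel, mul_one, mul_add] at *
  -- For `dr = 1` the inequality `k ≤ d` of the MSR code would read `e + 1 ≤ e`.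
  have hx : 0 < x := by
    rcases Nat.eq_zero_or_pos x with rfl | h
    · omega
    · exact h
  -- The MSR storage is `e * x * β`, so the cut-set bound becomes the claim after cancelling `(e +
  -- 1) * x`.
  rw [show e * x + e - (e + 1) + 1 = e * x by omega] at hle
  refine Nat.le_of_mul_le_mul_left ?_ (Nat.mul_pos e.succ_pos hx)
  calc (e + 1) * x * ((e * e + e) * β) = (e * (e + 1) + (e + 1)) * (e * x * β) := by ring
    _ ≤ (e + 1) * x * β' := by simpa [mul_add, add_mul] using hle

/-- A linear functional may be prescribed on independent vectors. -/
theorem exists_linearMap_eq {K L ι : Type*} [Field K] [Field L] [Algebra K L]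
    {y : ι → L} (hy : LinearIndependent K y) (x : ι → K) :
    ∃ φ : L →ₗ[K] K, ∀ n, φ (y n) = x n := by
  obtain ⟨φ, hφ⟩ := LinearMap.exists_extend ((Module.Basis.span hy).constr K x)
  refine ⟨φ, fun n => ?_⟩
  have h1 := LinearMap.congr_fun hφ (Module.Basis.span hy n)
  rw [Module.Basis.constr_basis] at h1
  simpa [Module.Basis.span_apply] using h1

/-! ### Gabidulin precoding across the local groups -/

section GlobalCode

variable {K L : Type*} [Field K] [Fintype K] [Field L] [Algebra K L]
  {M N g bL r c KL α m n' α' : ℕ}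

/-- The stored symbols are values of the linearized polynomial at combinations of the points. -/
theorem gabidulinDcbdCode_apply (y : Fin N → L) (grp : Fin N ≃ Fin g × Fin KL)
    (lay : DCBDLayout bL r c KL α m n' α') (G : Fin n' → Matrix (Fin α') (Fin m) K)
    (f : Fin M → L) (il : Fin g × Fin bL) (j : Fin c) (s : Fin α) :
    gabidulinDcbdCode M y grp lay G f il j s =
      linearizedMap K f (dcbdCode L lay G (fun t => y (grp.symm (il.1, t))) il.2 j s) := by
  rw [← dcbdCode_map]
  simp only [gabidulinDcbdCode, gabidulin_eq_linearizedMap]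

/-- The points at which `kc` nodes of each block of `S` evaluate the linearized polynomial are
independent. -/
theorem linearIndependent_observed {y : Fin N → L} (hy : LinearIndependent K y)
    (grp : Fin N ≃ Fin g × Fin KL) (lay : DCBDLayout bL r c KL α m n' α')
    (G : Fin n' → Matrix (Fin α') (Fin m) K) {kc : ℕ} (hloc : (dcbdCode K lay G).IsBFR kc 0)
    (hKL : KL = bL * kc * α) {S : Finset (Fin g × Fin bL)} {A : Fin g × Fin bL → Finset (Fin c)}
    (hA : ∀ i ∈ S, (A i).card = kc) :
    LinearIndependent K fun o : {x : (Fin g × Fin bL) × Fin c // x.1 ∈ S ∧ x.2 ∈ A x.1} × Fin α =>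
      dcbdCode L lay G (fun t => y (grp.symm (o.1.1.1.1, t))) o.1.1.1.2 o.1.1.2 o.2 := by
  classical
  obtain ⟨A₀, -, hA₀⟩ := Finset.exists_subset_card_eq (s := (Finset.univ : Finset (Fin c)))
    (n := kc) (by simpa using hloc.2.1)
  rw [Fintype.linearIndependent_iff]
  intro a ha o₀
  -- Local files whose read contents are the unit vector at `o₀`; the set `A₀` fills in the blocks
  -- outside `S`. A functional taking these values on `y` isolates the coefficient `a o₀`.
  have hx : ∀ i : Fin g, ∃ x : Fin KL → K, ∀ l, ∀ j ∈ (if (i, l) ∈ S then A (i, l) else A₀),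
      dcbdCode K lay G x l j =
        fun s => if ((i, l), j) = o₀.1.1 ∧ s = o₀.2 then (1 : K) else 0 := by
    intro i
    refine hloc.exists_file (by rw [Fintype.card_fin, hKL])
      (A := fun l => if (i, l) ∈ S then A (i, l) else A₀) (fun l => ?_) fun l j s =>
        if ((i, l), j) = o₀.1.1 ∧ s = o₀.2 then (1 : K) else 0
    split_ifs with h
    · exact hA _ h
    · exact hA₀
  choose x hx using hx
  obtain ⟨φ, hφ⟩ := exists_linearMap_eq hy fun n => x (grp n).1 (grp n).2
  have h1 := congrArg φ ha
  rw [map_zero, map_sum, Finset.sum_eq_single o₀] at h1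
  · have h2 := hx o₀.1.1.1.1 o₀.1.1.1.2 o₀.1.1.2 (by simpa [o₀.1.2.1] using o₀.1.2.2)
    rw [map_smul, ← dcbdCode_map] at h1
    simp only [hφ, Equiv.apply_symm_apply] at h1
    rw [h2] at h1
    simpa using h1
  · intro o _ ho
    have h2 := hx o.1.1.1.1 o.1.1.1.2 o.1.1.2 (by simpa [o.1.2.1] using o.1.2.2)
    rw [map_smul, ← dcbdCode_map]
    simp only [hφ, Equiv.apply_symm_apply]
    rw [h2]
    have hne : ¬ (((o.1.1.1.1, o.1.1.1.2), o.1.1.2) = o₀.1.1 ∧ o.2 = o₀.2) :=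
      fun h => ho (Prod.ext (Subtype.ext h.1) h.2)
    simp only [if_neg hne, smul_zero]
  · simp

/-- The `(b - ρ) * kc * α` symbols read are values of the polynomial at independent points, at least
as many as it has coefficients. -/
theorem gabidulinDcbdCode_isBFR {y : Fin N → L} (hy : LinearIndependent K y)
    (grp : Fin N ≃ Fin g × Fin KL) (lay : DCBDLayout bL r c KL α m n' α')
    (G : Fin n' → Matrix (Fin α') (Fin m) K) {kc ρ : ℕ} (hloc : (dcbdCode K lay G).IsBFR kc 0)
    (hKL : KL = bL * kc * α) (hρ : ρ < g * bL) (hM : M ≤ (g * bL - ρ) * kc * α) :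
    (gabidulinDcbdCode M y grp lay G).IsBFR kc ρ := by
  classical
  refine ⟨by simpa using hρ, hloc.2.1, fun S A hS hA f f' hff => ?_⟩
  have hcard := card_observed S A hA
  rw [Nat.card_eq_fintype_card, hS, Fintype.card_prod, Fintype.card_fin, Fintype.card_fin] at hcard
  refine sub_eq_zero.1 (eq_zero_of_linearizedMap_eq_zero
    (linearIndependent_observed hy grp lay G hloc hKL hA) ?_ fun o => ?_)
  · rwa [Fintype.card_prod, hcard, Fintype.card_fin]
  · rw [linearizedMap_sub, sub_eq_zero, ← gabidulinDcbdCode_apply, ← gabidulinDcbdCode_apply]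
    exact congrFun (congrFun hff o.1) o.2

theorem range_puncture_subset (y : Fin N → L) (grp : Fin N ≃ Fin g × Fin KL)
    (lay : DCBDLayout bL r c KL α m n' α') (G : Fin n' → Matrix (Fin α') (Fin m) K) (i : Fin g) :
    Set.range (BlockCode.puncture (gabidulinDcbdCode M y grp lay G) i) ⊆
      Set.range (dcbdCode L lay G) := by
  rintro _ ⟨f, rfl⟩
  exact ⟨fun t => gabidulin (Fintype.card K) y f (grp.symm (i, t)), rfl⟩

/-- The points of one group are independent, so interpolation produces any prescribed `KL` Gabidulin
symbols there. -/
theorem range_puncture_eq [Finite L] {y : Fin N → L} (hy : LinearIndependent K y)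
    (grp : Fin N ≃ Fin g × Fin KL) (lay : DCBDLayout bL r c KL α m n' α')
    (G : Fin n' → Matrix (Fin α') (Fin m) K) (hM : KL ≤ M) (i : Fin g) :
    Set.range (BlockCode.puncture (gabidulinDcbdCode M y grp lay G) i) =
      Set.range (dcbdCode L lay G) := by
  refine (range_puncture_subset y grp lay G i).antisymm ?_
  rintro _ ⟨x, rfl⟩
  have hz : LinearIndependent K fun t : Fin KL => y (grp.symm (i, t)) :=
    hy.comp _ fun t t' h => (Prod.ext_iff.1 (grp.symm.injective h)).2
  obtain ⟨f, hf⟩ := exists_linearizedMap_eq hz (by simpa using hM) x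
  refine ⟨f, ?_⟩
  have hx : (fun t => gabidulin (Fintype.card K) y f (grp.symm (i, t))) = x := by
    funext t
    rw [gabidulin_eq_linearizedMap, hf t]
  rw [← hx]
  rfl

end GlobalCode

/-! ### The main theorem -/

theorem mainTheorem11 {K L : Type*} [Field K] [Fintype K] [Field L] [Fintype L] [Algebra K L]
    {M N g bL σ kc dr c KL α m n' k' d' α' β' : ℕ}
    -- Gabidulin code of length `N` and dimension `M`, evaluated at `K`-independent points
    (hM : 0 < M) (hMN : M ≤ N) (y : Fin N → L) (hy : LinearIndependent K y)
    -- parameters of the local codes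
    (hσ : σ < bL - 1) (hk' : k' = (bL - 1) * kc) (hd' : d' = (bL - σ - 1) * dr) (hdr : dr ≤ c)
    -- the linear minimum storage regenerating sub-code
    (G : Fin n' → Matrix (Fin α') (Fin m) K) (hG : IsMSR (linearEncode K G) k' d' β')
    -- division into `g = b / bL` local groups, and the placement in each group
    (grp : Fin N ≃ Fin g × Fin KL) (lay : DCBDLayout bL (bL - σ) c KL α m n' α')
    -- `N / b ∣ M`, where `b = g * bL`
    (hdvd : N / (g * bL) ∣ M) :
    let C : BlockCode L M (Fin g × Fin bL) c α := gabidulinDcbdCode M y grp lay G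
    let β := (bL - σ - 1) * (bL - 1) * β'
    -- the code is an LRC whose local codes are BFR regenerating codes with minimum storage
    (∀ i, Set.range (C.puncture i) ⊆ Set.range (dcbdCode L lay G)) ∧
    (KL ≤ M → ∀ i, Set.range (C.puncture i) = Set.range (dcbdCode L lay G)) ∧
    (dcbdCode L lay G).IsMinStorage kc 0 dr σ β ∧
    C.IsMinStorageLRC KL kc 0 dr σ β ∧
    -- and BFR-MSR codes if `k_L = b_L / σ_L`
    (bL * kc * σ = bL → (dcbdCode L lay G).IsBFRMSR kc 0 dr σ β ∧
      C.IsBFRMSRLRC KL kc 0 dr σ β) ∧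
    -- the bound holds for all LRCs with minimum-storage local codes, in particular all BFR-MSR-LRCs
    (∀ (F : Type) [Field F] [Fintype F] (M₁ g₁ bL₁ c₁ α₁ KL₁ kc₁ dr₁ σ₁ β₁ ρ₁ : ℕ)
      (C₁ : BlockCode F M₁ (Fin g₁ × Fin bL₁) c₁ α₁),
      C₁.IsMinStorageLRC KL₁ kc₁ 0 dr₁ σ₁ β₁ → C₁.resilience kc₁ = ρ₁ →
      (M₁ : ℚ) ≤ fileSizeBound (g₁ * bL₁) bL₁ KL₁ ρ₁) ∧
    -- the code meets it with equality, and no such code with the same `b`, `bL`, `KL` and at least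
    -- the same resilience stores a larger file
    ∃ ρ : ℕ, C.resilience kc = ρ ∧ C.IsBFR kc ρ ∧
      (M : ℚ) = fileSizeBound (g * bL) bL KL ρ ∧
      ∀ (F : Type) [Field F] [Fintype F] (M₁ c₁ α₁ kc₁ dr₁ σ₁ β₁ : ℕ)
        (C₁ : BlockCode F M₁ (Fin g × Fin bL) c₁ α₁),
        C₁.IsMinStorageLRC KL kc₁ 0 dr₁ σ₁ β₁ → (ρ : ℤ) ≤ C₁.resilience kc₁ → M₁ ≤ M := by
  intro C β
  subst hk' hd'
  have hGL : IsMSR (linearEncode L G) ((bL - 1) * kc) ((bL - σ - 1) * dr) β' := hG.extendScalars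
  have hmin : (dcbdCode L lay G).IsMinStorage kc 0 dr σ β :=
    dcbdCode_isMinStorage lay G rfl hσ hdr hGL
  have hKL : KL = bL * kc * α := by
    have := hmin.2
    rwa [Fintype.card_fin, Nat.sub_zero] at this
  have hN : N = g * bL * (kc * α) := by
    have := Fintype.card_congr grp
    rw [Fintype.card_fin, Fintype.card_prod, Fintype.card_fin, Fintype.card_fin, hKL] at this
    rw [this]
    ring
  have hpos : 0 < g * bL * (kc * α) := by omega
  have hb : 0 < g * bL := Nat.pos_of_mul_pos_right hpos
  have hs : 0 < kc * α := Nat.pos_of_mul_pos_left hpos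
  have hsub := range_puncture_subset (M := M) y grp lay G
  refine ⟨hsub, fun hKM => range_puncture_eq hy grp lay G hKM, hmin,
    fun i => ⟨_, hsub i, hmin⟩, fun hkσ => ?_, ?_, ?_⟩
  -- The condition `k_L = b_L / σ_L` is `kc * σ = 1` in natural numbers, hence `kc = σ = 1`.
  · have hkσ1 : kc * σ = 1 := by
      refine Nat.eq_of_mul_eq_mul_left (show 0 < bL by omega) ?_
      rw [← mul_assoc, hkσ, mul_one]
    obtain ⟨rfl, rfl⟩ := mul_eq_one.1 hkσ1
    have hmsr := dcbdCode_isBFRMSR lay G rfl hσ hdr hGL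
    exact ⟨hmsr, fun i => ⟨_, hsub i, hmsr⟩⟩
  · intro F _ _ M₁ g₁ bL₁ c₁ α₁ KL₁ kc₁ dr₁ σ₁ β₁ ρ₁ C₁ hC₁ hρ₁
    exact hC₁.fileSize_le hρ₁.ge
  · rw [hN, Nat.mul_div_cancel_left _ hb] at hdvd
    -- Each block contributes `kc * α` symbols, so `t` is the number of blocks that hold exactly a
    -- file's worth.
    obtain ⟨t, ht⟩ := hdvd
    have ht0 : 0 < t := Nat.pos_of_mul_pos_left (ht ▸ hM)
    have htb : t ≤ g * bL := by
      refine Nat.le_of_mul_le_mul_left ?_ hs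
      rw [← ht, mul_comm (kc * α), ← hN]
      exact hMN
    have hbt : g * bL - (g * bL - t) = t := by omega
    -- Independence of the evaluation points is over `K`, so the local code over `K` enters here,
    -- not its extension to `L`.
    have hBFR : C.IsBFR kc (g * bL - t) := by
      refine gabidulinDcbdCode_isBFR hy grp lay G
        (dcbdCode_isBFR lay G (by omega) (by omega) hG) hKL (by omega) ?_
      rw [hbt, ht, mul_assoc t, mul_comm t]
    have hres : C.resilience kc = (g * bL - t : ℕ) := by
      refine hBFR.resilience_eq ?_
      rw [Fintype.card_prod, Fintype.card_fin, Fintype.card_fin, hbt, ht, mul_assoc,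
        mul_comm (kc * α)]
      exact Nat.mul_lt_mul_of_pos_right (by omega) hs
    have hbound : (M : ℚ) = fileSizeBound (g * bL) bL KL (g * bL - t) := by
      rw [hKL, mul_assoc, fileSizeBound_eq (by omega), hbt, ht, mul_comm t]
    refine ⟨g * bL - t, hres, hBFR, hbound, ?_⟩
    intro F _ _ M₁ c₁ α₁ kc₁ dr₁ σ₁ β₁ C₁ hC₁ hρ₁
    have hle := hC₁.fileSize_le hρ₁
    rw [← hbound] at hle
    exact_mod_cast hle
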